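/- **Setting.** Write $\langle x\rangle=(1+|x|^2)^{1/2}$ and let $\mathcal E[\mathbb R^d]$ be the set of nets $(u_\epsilon)_{\epsilon\in(0,1]}$ of smooth functions $u_\epsilon:\mathbb R^d\to\mathbb C$. Let * $\mathcal E_\tau(\mathbb R^d)$ be the nets in $\mathcal E[\mathbb R^d]$ such that for all $\alpha\in\mathbb N^d$ there is $N\in\mathbb N$ with $\sup_{\epsilon\in(0,1]}\epsilon^N\|\langle x\rangle^{-N}\partial^\alpha u_\epsilon\|_{L^\infty}<\infty$; * $\mathcal N_{\mathcal S}(\mathbb R^d)$ be the nets in $\mathcal E[\mathbb R^d]$ such that for all $\alpha,\beta\in\mathbb N^d$ and $q\in\mathbb N$, $\sup_{\epsilon\in(0,1]}\epsilon^{-q}\|x^\alpha\partial^\beta u_\epsilon\|_{L^\infty}<\infty$; * $\mathcal G_{\tau,\mathcal S}(\mathbb R^d)=\mathcal E_\tau(\mathbb R^d)/\mathcal N_{\mathcal S}(\mathbb R^d)$; * $\mathcal G^\infty_{\mathcal S}(\mathbb R^d)\subset\mathcal G_{\tau,\mathcal S}(\mathbb R^d)$ be the set of classes having a representative for which there is $N\in\mathbb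 N$ such that for all $\alpha,\beta\in\mathbb N^d$, $\sup_{\epsilon\in(0,1]}\epsilon^{N}\|x^\alpha\partial^\beta u_\epsilon\|_{L^\infty}<\infty$. Fix $n$ and a mollifier $\varphi\in\mathcal S(\mathbb R^n)$, i.e. $\int\varphi=1$ and $\int x^\alpha\varphi(x)\,dx=0$ for all $\alpha\ne0$; put $\varphi_\epsilon(x)=\epsilon^{-n}\varphi(x/\epsilon)$ and $\widehat{\varphi_\epsilon}(y)=\int e^{-ixy}\varphi_\epsilon(x)\,dx$. A weight function is a continuous $\Lambda:\mathbb R^{2n}\to\mathbb R$ such that, for some $\mu>0$ and suitable positive constants $c$: (i) $\langle z\rangle^\mu\le c\,\Lambda(z)$ and $\Lambda(z)\le c\,\langle z\rangle$ for all $z$; (ii) $\Lambda(z)\le c\,\Lambda(\zeta)$ and $\Lambda(\zeta)\le c\,\Lambda(z)$ whenever $|\zeta-z|\le\mu\Lambda(z)$; (iii) for every $t\in\mathbb R^{2n}$ there is $c$ with $\Lambda(t_1z_1,\dots,t_{2n}z_{2n})\le c\,\Lambda(z)$ for all $z$. For a weight function $\Lambda$ and $\rho\in(0,1]$ let $\mathcal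 S^m_{\Lambda,\rho,N}$ ($m\in\mathbb R$, $N\in\mathbb N$) be the set of $(a_\epsilon)_\epsilon\in\mathcal E[\mathbb R^{2n}]$ such that for every $\alpha\in\mathbb N^{2n}$ there is $c>0$ with $|\partial^\alpha a_\epsilon(z)|\le c\,\Lambda(z)^{m-\rho|\alpha|}\epsilon^{-N}$ for all $\epsilon\in(0,1]$ and $z\in\mathbb R^{2n}$. The smoothing symbols are the elements of $\mathcal S^{-\infty}=\bigcup_{N\in\mathbb N}\bigcap_{m\in\mathbb R}\mathcal S^m_{\Lambda,\rho,N}$. Let $A:\mathcal G_{\tau,\mathcal S}(\mathbb R^n)\to\mathcal G_{\tau,\mathcal S}(\mathbb R^n)$ be a linear map. * $A$ is an *operator with $\mathcal S$-regular kernel* if there is $k_A\in\mathcal G^\infty_{\mathcal S}(\mathbb R^{2n})$ such that $Au=\int_{\mathbb R^n}k_A(\cdot,y)u(y)\,dy$ for all $u$, where the right-hand side is the class of $\int_{\mathbb R^n}k_{A,\epsilon}(x,y)u_\epsilon(y)\widehat{\varphi_\epsilon}(y)\,dy$, for any representatives of $k_A$ and $u$. * $A$ is the *pseudo-differential operator with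 symbol* $(a_\epsilon)_\epsilon$ if, for every $u$ and every representative $(u_\epsilon)_\epsilon$ of $u$, $Au$ is the class of $$A_\epsilon u_\epsilon(x)=(2\pi)^{-n}\int_{\mathbb R^{2n}}e^{i(x-y)\xi}a_\epsilon(x,\xi)u_\epsilon(y)\widehat{\varphi_\epsilon}(y)\,dy\,d\xi ,$$ the integral being understood as an oscillatory integral (insert a factor $\psi(hy,h\xi)$ with $\psi\in\mathcal S(\mathbb R^{2n})$, $\psi(0)=1$, and let $h\to0^+$; the limit does not depend on $\psi$). **Proposition.** For every weight function $\Lambda$ and every $\rho\in(0,1]$, a linear map $A:\mathcal G_{\tau,\mathcal S}(\mathbb R^n)\to\mathcal G_{\tau,\mathcal S}(\mathbb R^n)$ is an operator with $\mathcal S$-regular kernel if and only if it is the pseudo-differential operator with symbol $(a_\epsilon)_\epsilon$ for some smoothing symbol $(a_\epsilon)_\epsilon\in\mathcal S^{-\infty}$. -/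

import Mathlib

open scoped ContDiff SchwartzMap Topology

noncomputable section

namespace Colombeau

/-- The Euclidean space of dimension `n`. The space of dimension `2n` is `Rn n × Rn n`; its product
norm is equivalent to the Euclidean norm, and the estimates on it below, whose constants may depend
on the orders involved, are insensitive to the choice between the two. -/
abbrev Rn (n : ℕ) : Type := EuclideanSpace ℝ (Fin n)

/-- The range `(0,1]` of the parameter `ε`. -/
abbrev Eps : Type := Set.Ioc (0 : ℝ) 1

/-- The bracket `⟨x⟩ = (1 + |x|^2)^(1/2)`. -/
def bracket {V : Type*} [NormedAddCommGroup V] (x : V) : ℝ := Real.sqrt (1 + ‖x‖ ^ 2)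

theorem one_le_bracket {V : Type*} [NormedAddCommGroup V] (x : V) : 1 ≤ bracket x := by
  unfold bracket
  rw [Real.one_le_sqrt]
  nlinarith [sq_nonneg ‖x‖]

section Spaces

variable (V : Type*) [NormedAddCommGroup V] [NormedSpace ℝ V]

/-- `𝓔[V]`: nets of smooth functions. As for Mathlib's Schwartz functions, the size of all partial
derivatives of order `k` is measured by the norm of the `k`-th iterated derivative. -/
def SmoothNets : Submodule ℂ (Eps → V → ℂ) where
  carrier := {u | ∀ ε, ContDiff ℝ ∞ (u ε)}
  add_mem' hu hv ε := (hu ε).add (hv ε)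
  zero_mem' _ := contDiff_const
  smul_mem' c _ hu ε := ContDiff.const_smul c (hu ε)

variable {V} in
theorem SmoothNets.contDiffAt {u : Eps → V → ℂ} (hu : u ∈ SmoothNets V) (ε : Eps) (k : ℕ) (x : V) :
    ContDiffAt ℝ k (u ε) x :=
  (ContDiff.of_le (show ContDiff ℝ ∞ (u ε) from hu ε) (by exact_mod_cast le_top)).contDiffAt

variable {V} in
theorem SmoothNets.norm_iteratedFDeriv_add_le {u v : Eps → V → ℂ} (hu : u ∈ SmoothNets V)
    (hv : v ∈ SmoothNets V) (ε : Eps) (k : ℕ) (x : V) :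
    ‖iteratedFDeriv ℝ k ((u + v) ε) x‖ ≤
      ‖iteratedFDeriv ℝ k (u ε) x‖ + ‖iteratedFDeriv ℝ k (v ε) x‖ := by
  rw [Pi.add_apply, iteratedFDeriv_add_apply (contDiffAt hu ε k x) (contDiffAt hv ε k x)]
  exact norm_add_le _ _

variable {V} in
theorem SmoothNets.norm_iteratedFDeriv_smul {u : Eps → V → ℂ} (hu : u ∈ SmoothNets V)
    (c : ℂ) (ε : Eps) (k : ℕ) (x : V) :
    ‖iteratedFDeriv ℝ k ((c • u) ε) x‖ = ‖c‖ * ‖iteratedFDeriv ℝ k (u ε) x‖ := by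
  rw [Pi.smul_apply, iteratedFDeriv_const_smul_apply (contDiffAt hu ε k x), norm_smul]

/-- `𝓔_τ(V)`: for all `k` there is `N` with
`sup_ε ε^N ‖⟨x⟩^(-N) ∂^k u_ε‖_∞ < ∞`. -/
def Tempered : Submodule ℂ (Eps → V → ℂ) where
  carrier := {u | u ∈ SmoothNets V ∧ ∀ k : ℕ, ∃ N : ℕ, ∃ C : ℝ, ∀ (ε : Eps) (x : V),
    (ε : ℝ) ^ N * ‖iteratedFDeriv ℝ k (u ε) x‖ ≤ C * bracket x ^ N}
  add_mem' := by
    rintro u v ⟨hu, hu2⟩ ⟨hv, hv2⟩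
    refine ⟨add_mem hu hv, fun k => ?_⟩
    obtain ⟨N, C, h⟩ := hu2 k
    obtain ⟨M, D, h2⟩ := hv2 k
    refine ⟨N + M, |C| + |D|, fun ε x => ?_⟩
    have e0 : (0 : ℝ) ≤ ε := ε.2.1.le
    have e1 : ∀ m : ℕ, (ε : ℝ) ^ m ≤ 1 := fun m => pow_le_one₀ e0 ε.2.2
    have b1 : ∀ m : ℕ, 1 ≤ bracket x ^ m := fun m => one_le_pow₀ (one_le_bracket x)
    have hA : (ε : ℝ) ^ (N + M) * ‖iteratedFDeriv ℝ k (u ε) x‖ ≤ |C| * bracket x ^ (N + M) := by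
      calc (ε : ℝ) ^ (N + M) * ‖iteratedFDeriv ℝ k (u ε) x‖
          = ε ^ M * (ε ^ N * ‖iteratedFDeriv ℝ k (u ε) x‖) := by ring
        _ ≤ 1 * (ε ^ N * ‖iteratedFDeriv ℝ k (u ε) x‖) := by gcongr; exact e1 M
        _ ≤ C * bracket x ^ N := by rw [one_mul]; exact h ε x
        _ ≤ |C| * bracket x ^ (N + M) := by
          gcongr
          · exact (zero_le_one.trans (b1 N))
          · exact le_abs_self C
          · exact one_le_bracket x
          · exact Nat.le_add_right _ _
    have hB : (ε : ℝ) ^ (N + M) * ‖iteratedFDeriv ℝ k (v ε) x‖ ≤ |D| * bracket x ^ (N + M) := by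
      calc (ε : ℝ) ^ (N + M) * ‖iteratedFDeriv ℝ k (v ε) x‖
          = ε ^ N * (ε ^ M * ‖iteratedFDeriv ℝ k (v ε) x‖) := by ring
        _ ≤ 1 * (ε ^ M * ‖iteratedFDeriv ℝ k (v ε) x‖) := by gcongr; exact e1 N
        _ ≤ D * bracket x ^ M := by rw [one_mul]; exact h2 ε x
        _ ≤ |D| * bracket x ^ (N + M) := by
          gcongr
          · exact (zero_le_one.trans (b1 M))
          · exact le_abs_self D
          · exact one_le_bracket x
          · exact Nat.le_add_left _ _
    calc (ε : ℝ) ^ (N + M) * ‖iteratedFDeriv ℝ k ((u + v) ε) x‖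
        ≤ ε ^ (N + M) * (‖iteratedFDeriv ℝ k (u ε) x‖ + ‖iteratedFDeriv ℝ k (v ε) x‖) := by
          gcongr; exact SmoothNets.norm_iteratedFDeriv_add_le hu hv ε k x
      _ ≤ (|C| + |D|) * bracket x ^ (N + M) := by rw [mul_add, add_mul]; exact add_le_add hA hB
  zero_mem' := by
    refine ⟨zero_mem _, fun k => ⟨0, 0, fun ε x => ?_⟩⟩
    simp
  smul_mem' := by
    rintro c u ⟨hu, hu2⟩
    refine ⟨Submodule.smul_mem _ c hu, fun k => ?_⟩
    obtain ⟨N, C, h⟩ := hu2 k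
    refine ⟨N, ‖c‖ * C, fun ε x => ?_⟩
    rw [SmoothNets.norm_iteratedFDeriv_smul hu]
    calc (ε : ℝ) ^ N * (‖c‖ * ‖iteratedFDeriv ℝ k (u ε) x‖)
        = ‖c‖ * (ε ^ N * ‖iteratedFDeriv ℝ k (u ε) x‖) := by ring
      _ ≤ ‖c‖ * (C * bracket x ^ N) := mul_le_mul_of_nonneg_left (h ε x) (norm_nonneg c)
      _ = ‖c‖ * C * bracket x ^ N := by ring

/-- `𝓝_𝓢(V)`: for all orders `j, k` and all `q`,
`sup_ε ε^(-q) ‖ |x|^j ∂^k u_ε ‖_∞ < ∞`. -/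
def Negligible : Submodule ℂ (Eps → V → ℂ) where
  carrier := {u | u ∈ SmoothNets V ∧ ∀ j k q : ℕ, ∃ C : ℝ, ∀ (ε : Eps) (x : V),
    ‖x‖ ^ j * ‖iteratedFDeriv ℝ k (u ε) x‖ ≤ C * (ε : ℝ) ^ q}
  add_mem' := by
    rintro u v ⟨hu, hu2⟩ ⟨hv, hv2⟩
    refine ⟨add_mem hu hv, fun j k q => ?_⟩
    obtain ⟨C, h⟩ := hu2 j k q
    obtain ⟨D, h2⟩ := hv2 j k q
    refine ⟨C + D, fun ε x => ?_⟩
    calc ‖x‖ ^ j * ‖iteratedFDeriv ℝ k ((u + v) ε) x‖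
        ≤ ‖x‖ ^ j * (‖iteratedFDeriv ℝ k (u ε) x‖ + ‖iteratedFDeriv ℝ k (v ε) x‖) := by
          gcongr; exact SmoothNets.norm_iteratedFDeriv_add_le hu hv ε k x
      _ ≤ (C + D) * (ε : ℝ) ^ q := by
          rw [mul_add, add_mul]; exact add_le_add (h ε x) (h2 ε x)
  zero_mem' := by
    refine ⟨zero_mem _, fun j k q => ⟨0, fun ε x => ?_⟩⟩
    simp
  smul_mem' := by
    rintro c u ⟨hu, hu2⟩
    refine ⟨Submodule.smul_mem _ c hu, fun j k q => ?_⟩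
    obtain ⟨C, h⟩ := hu2 j k q
    refine ⟨‖c‖ * C, fun ε x => ?_⟩
    rw [SmoothNets.norm_iteratedFDeriv_smul hu]
    calc ‖x‖ ^ j * (‖c‖ * ‖iteratedFDeriv ℝ k (u ε) x‖)
        = ‖c‖ * (‖x‖ ^ j * ‖iteratedFDeriv ℝ k (u ε) x‖) := by ring
      _ ≤ ‖c‖ * (C * (ε : ℝ) ^ q) := mul_le_mul_of_nonneg_left (h ε x) (norm_nonneg c)
      _ = ‖c‖ * C * (ε : ℝ) ^ q := by ring

theorem negligible_le_tempered : Negligible V ≤ Tempered V := by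
  rintro u ⟨hu, h⟩
  refine ⟨hu, fun k => ?_⟩
  obtain ⟨C, hC⟩ := h 0 k 0
  exact ⟨0, C, fun ε x => by simpa using hC ε x⟩

/-- `𝓖_{τ,𝓢}(V) = 𝓔_τ(V) / 𝓝_𝓢(V)`. -/
abbrev GtauS : Type _ := Tempered V ⧸ (Negligible V).submoduleOf (Tempered V)

variable {V}

/-- The class in `𝓖_{τ,𝓢}(V)` of a net in `𝓔_τ(V)`. -/
def GtauS.mk (u : Tempered V) : GtauS V := Submodule.Quotient.mk u

/-- The estimate defining `𝓔^∞_𝓢(V)`: there is `N` such that for all orders `j, k`,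
`sup_ε ε^N ‖ |x|^j ∂^k u_ε ‖_∞ < ∞`. -/
def IsSRegularNet (u : Eps → V → ℂ) : Prop :=
  u ∈ SmoothNets V ∧ ∃ N : ℕ, ∀ j k : ℕ, ∃ C : ℝ, ∀ (ε : Eps) (x : V),
    (ε : ℝ) ^ N * (‖x‖ ^ j * ‖iteratedFDeriv ℝ k (u ε) x‖) ≤ C

variable (V) in
/-- `𝓖^∞_𝓢(V)`: the classes that have a representative in `𝓔^∞_𝓢(V)`. -/
def SRegular : Set (GtauS V) := {w | ∃ u : Tempered V, GtauS.mk u = w ∧ IsSRegularNet u.1}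

end Spaces

variable {n : ℕ}

/-- A mollifier: a Schwartz function with integral one, all of whose higher moments vanish. -/
def IsMollifier (φ : 𝓢(Rn n, ℂ)) : Prop :=
  ∫ x, φ x = 1 ∧ ∀ α : Fin n → ℕ, α ≠ 0 → ∫ x : Rn n, ((∏ i, x i ^ α i : ℝ) : ℂ) * φ x = 0

/-- `φ_ε(x) = ε^(-n) φ(x / ε)`. -/
def scaled (φ : 𝓢(Rn n, ℂ)) (ε : Eps) (x : Rn n) : ℂ :=
  (((ε : ℝ) ^ n)⁻¹ : ℝ) * φ ((ε : ℝ)⁻¹ • x)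

/-- The Fourier transform of `φ_ε`, that is `∫ e^(-i x·y) φ_ε(x) dx`. -/
def scaledHat (φ : 𝓢(Rn n, ℂ)) (ε : Eps) (y : Rn n) : ℂ :=
  ∫ x : Rn n, Complex.exp (-Complex.I * (inner ℝ x y : ℝ)) * scaled φ ε x

/-- `A` is an operator with `𝓢`-regular kernel: there is `k_A` in `𝓖^∞_𝓢(ℝ^{2n})` with
`A u = ∫ k_A(·, y) u(y) dy` for all `u`. The generalized function on the right is the class of the
net `∫ k_ε(x,y) u_ε(y) (φ_ε)^(y) dy`, for any representatives of `k_A` and `u`. -/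
def HasSRegularKernel (φ : 𝓢(Rn n, ℂ)) (A : GtauS (Rn n) →ₗ[ℂ] GtauS (Rn n)) : Prop :=
  ∃ kA ∈ SRegular (Rn n × Rn n),
    ∀ k : Tempered (Rn n × Rn n), GtauS.mk k = kA → ∀ u : Tempered (Rn n),
      ∃ v : Tempered (Rn n),
        (∀ ε x, v.1 ε x = ∫ y : Rn n, k.1 ε (x, y) * u.1 ε y * scaledHat φ ε y) ∧
        A (GtauS.mk u) = GtauS.mk v

/-- The Euclidean norm on the space of dimension `2n`. -/
def euclNorm (z : Rn n × Rn n) : ℝ := Real.sqrt (‖z.1‖ ^ 2 + ‖z.2‖ ^ 2)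

/-- The bracket `(1 + |z|^2)^(1/2)` with the Euclidean norm on the space of dimension `2n`. -/
def euclBracket (z : Rn n × Rn n) : ℝ := Real.sqrt (1 + euclNorm z ^ 2)

/-- Coordinatewise product `(t₁ z₁, …, t_{2n} z_{2n})`. -/
def coordMul (t z : Rn n × Rn n) : Rn n × Rn n :=
  (WithLp.toLp 2 fun i => t.1 i * z.1 i, WithLp.toLp 2 fun i => t.2 i * z.2 i)

/-- Weight functions on the space of dimension `2n`. -/
def IsWeight (Λ : Rn n × Rn n → ℝ) : Prop :=
  Continuous Λ ∧
  (∃ μ : ℝ, 0 < μ ∧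
    (∃ c : ℝ, 0 < c ∧ ∀ z, euclBracket z ^ μ ≤ c * Λ z) ∧
    (∃ c : ℝ, 0 < c ∧ ∀ z, Λ z ≤ c * euclBracket z) ∧
    (∃ c : ℝ, 0 < c ∧ ∀ z ζ, euclNorm (ζ - z) ≤ μ * Λ z → Λ z ≤ c * Λ ζ ∧ Λ ζ ≤ c * Λ z)) ∧
  ∀ t, ∃ c : ℝ, 0 < c ∧ ∀ z, Λ (coordMul t z) ≤ c * Λ z

/-- `𝓢^m_{Λ,ρ,N}`: regular symbols. -/
def Symbols (Λ : Rn n × Rn n → ℝ) (ρ m : ℝ) (N : ℕ) : Set (Eps → Rn n × Rn n → ℂ) :=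
  {a | a ∈ SmoothNets (Rn n × Rn n) ∧ ∀ k : ℕ, ∃ c : ℝ, 0 < c ∧ ∀ (ε : Eps) (z : Rn n × Rn n),
    ‖iteratedFDeriv ℝ k (a ε) z‖ ≤ c * Λ z ^ (m - ρ * k) * ((ε : ℝ) ^ N)⁻¹}

/-- `𝓢^{-∞} = ⋃_N ⋂_m 𝓢^m_{Λ,ρ,N}`: smoothing symbols. -/
def SmoothingSymbols (Λ : Rn n × Rn n → ℝ) (ρ : ℝ) : Set (Eps → Rn n × Rn n → ℂ) :=
  ⋃ N : ℕ, ⋂ m : ℝ, Symbols Λ ρ m N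

/-- `I` is the oscillatory integral `∫ e^{iθ(z)} b(z) dz`: the limit, as `h → 0+`, of the absolutely
convergent integrals `∫ e^{iθ(z)} b(z) ψ(hz) dz`, for every Schwartz function `ψ` with
`ψ(0) = 1`. -/
def IsOscIntegral (θ : Rn n × Rn n → ℝ) (b : Rn n × Rn n → ℂ) (I : ℂ) : Prop :=
  ∀ ψ : 𝓢(Rn n × Rn n, ℂ), ψ 0 = 1 →
    (∀ h : ℝ, 0 < h → MeasureTheory.Integrable
      fun z => Complex.exp (Complex.I * θ z) * b z * ψ (h • z)) ∧
    Filter.Tendsto (fun h : ℝ => ∫ z, Complex.exp (Complex.I * θ z) * b z * ψ (h • z))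
      (𝓝[>] 0) (𝓝 I)

/-- `A` is the pseudo-differential operator with amplitude `(a_ε(x,y,ξ))_ε`: the image of the class
of `(u_ε)_ε` is the class of the net given by the oscillatory integrals
`∫ e^{i(x-y)ξ} a_ε(x,y,ξ) u_ε(y) (φ_ε)^(y) dy dξ / (2π)^n`, with phase `-y·ξ` in `(y,ξ)`. -/
def IsPseudoDiffOp (φ : 𝓢(Rn n, ℂ)) (a : Eps → Rn n → Rn n → Rn n → ℂ)
    (A : GtauS (Rn n) →ₗ[ℂ] GtauS (Rn n)) : Prop :=
  ∀ u : Tempered (Rn n), ∃ v : Tempered (Rn n),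
    (∀ ε x, IsOscIntegral (fun z => -inner ℝ z.1 z.2)
      (fun z => (((2 * Real.pi) ^ n)⁻¹ : ℝ) * (Complex.exp (Complex.I * (inner ℝ x z.2 : ℝ)) *
        a ε x z.1 z.2 * u.1 ε z.1 * scaledHat φ ε z.1)) (v.1 ε x)) ∧
    A (GtauS.mk u) = GtauS.mk v

end Colombeau

end

/-!
A kernel `k` and a symbol `a` that define the same operator are related by
`k(x,y) = (2π)^{-n} ∫ e^{i(x-y)ξ} a(x,ξ) dξ`, that is, by a partial Fourier transform followed by
a linear change of variables. This is a topological automorphism of `𝓢(ℝ^n × ℝ^n)`, so it preserves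
the nets all of whose Schwartz seminorms are `O(ε^{-N})` with one and the same `N`. These are the
representatives of the `𝓢`-regular kernels and, because a weight function is bounded above and below
by positive powers of `1 + ‖z‖`, they are also exactly the smoothing symbols. For such a symbol the
oscillatory integral converges absolutely, and Fubini's theorem turns it into the integral against
`k`. Two representatives of the same kernel give the same operator, because multiplication by a
tempered net and integration in `y` keep a net negligible.
-/

noncomputable section

namespace Colombeau

open MeasureTheory Filter
open scoped FourierTransform

section Slices

variable {X W E : Type*} [NormedAddCommGroup X] [NormedSpace ℝ X] [NormedAddCommGroup W]
  [NormedSpace ℝ W] [NormedAddCommGroup E] [NormedSpace ℝ E]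

/-- The restriction `f ↦ f (x, ·)` of Schwartz functions on a product to the slice over `x`. -/
def slice (x : X) : 𝓢(X × W, E) →L[ℝ] 𝓢(W, E) :=
  SchwartzMap.compCLMOfAntilipschitz ℝ (g := fun w => (x, w)) (K := 1)
    (by
      have h : (fun w : W => (x, w)) = fun w => (x, 0) + ContinuousLinearMap.inr ℝ X W w := by
        ext w <;> simp
      rw [h]
      exact (Function.HasTemperateGrowth.const _).add
        (ContinuousLinearMap.inr ℝ X W).hasTemperateGrowth)
    (AntilipschitzWith.of_le_mul_dist fun w w' => by simp [Prod.dist_eq])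

@[simp]
theorem slice_apply (x : X) (f : 𝓢(X × W, E)) (w : W) : slice x f w = f (x, w) := rfl

theorem ext_slice {f g : 𝓢(X × W, E)} (h : ∀ x, slice x f = slice x g) : f = g :=
  SchwartzMap.ext fun z => DFunLike.congr_fun (h z.1) z.2

theorem norm_iteratedFDeriv_slice_le (f : 𝓢(X × W, E)) (k : ℕ) (x : X) (w : W) :
    ‖iteratedFDeriv ℝ k (slice x f) w‖ ≤ ‖iteratedFDeriv ℝ k f (x, w)‖ := by
  have h : ⇑(slice x f) = (fun z => f ((x, 0) + z)) ∘ ContinuousLinearMap.inr ℝ X W := by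
    ext w; simp
  have hg : ContDiff ℝ k fun z => f ((x, 0) + z) := (f.smooth k).comp (by fun_prop)
  rw [h, ContinuousLinearMap.iteratedFDeriv_comp_right _ hg w le_rfl, iteratedFDeriv_comp_add_left]
  simp only [ContinuousLinearMap.inr_apply, Prod.mk_add_mk, add_zero, zero_add]
  refine (ContinuousMultilinearMap.norm_compContinuousLinearMap_le _ _).trans ?_
  exact mul_le_of_le_one_right (norm_nonneg _) (Finset.prod_le_one (fun _ _ => norm_nonneg _)
    fun _ _ => ContinuousLinearMap.norm_inr_le_one ℝ X W)

theorem norm_pow_mul_seminorm_slice_le (f : 𝓢(X × W, E)) (l j k : ℕ) (x : X) :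
    ‖x‖ ^ l * SchwartzMap.seminorm ℝ j k (slice x f) ≤ SchwartzMap.seminorm ℝ (l + j) k f := by
  have h : SchwartzMap.seminorm ℝ j k (‖x‖ ^ l • slice x f) ≤
      SchwartzMap.seminorm ℝ (l + j) k f := by
    refine SchwartzMap.seminorm_le_bound ℝ j k _ (apply_nonneg _ _) fun w => ?_
    refine le_trans ?_ (SchwartzMap.le_seminorm ℝ (l + j) k f (x, w))
    rw [FunLike.coe_smul, iteratedFDeriv_const_smul_apply ((slice x f).contDiffAt k),
      norm_smul, norm_pow, norm_norm, mul_left_comm, ← mul_assoc, pow_add]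
    gcongr ?_ ^ l * ?_ ^ j * ?_
    · exact norm_fst_le (x, w)
    · exact norm_snd_le (x, w)
    · exact norm_iteratedFDeriv_slice_le f k x w
  rwa [map_smul_eq_mul, norm_pow, norm_norm] at h

theorem exists_seminorm_slice_le {q : Seminorm ℝ 𝓢(W, E)} (hq : Continuous q) (l : ℕ) :
    ∃ p : Seminorm ℝ 𝓢(X × W, E), Continuous p ∧ ∀ f x, ‖x‖ ^ l * q (slice x f) ≤ p f := by
  obtain ⟨s, C, -, hqC⟩ := Seminorm.bound_of_continuous (schwartz_withSeminorms ℝ W E) q hq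
  let p : ℕ × ℕ → Seminorm ℝ 𝓢(X × W, E) := fun i => SchwartzMap.seminorm ℝ (l + i.1) i.2
  refine ⟨C • s.sup p, ?_, fun f x => ?_⟩
  · exact (Seminorm.continuous_finsetSup fun i _ =>
      (schwartz_withSeminorms ℝ (X × W) E).continuous_seminorm (l + i.1, i.2)).const_smul C
  calc ‖x‖ ^ l * q (slice x f)
      = q (‖x‖ ^ l • slice x f) := by rw [map_smul_eq_mul, norm_pow, norm_norm]
    _ ≤ C * s.sup (schwartzSeminormFamily ℝ W E) (‖x‖ ^ l • slice x f) := hqC _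
    _ ≤ C * s.sup p f := by
      gcongr
      refine Seminorm.finset_sup_apply_le (apply_nonneg _ _) fun i hi => ?_
      rw [map_smul_eq_mul, norm_pow, norm_norm]
      exact (norm_pow_mul_seminorm_slice_le f l i.1 i.2 x).trans
        (Seminorm.le_finset_sup_apply (p := p) hi)

theorem exists_integrable_norm_slice_le [MeasurableSpace W] (μ : Measure W)
    [μ.HasTemperateGrowth] (f : 𝓢(X × W, E)) :
    ∃ B : W → ℝ, Integrable B μ ∧ ∀ x w, ‖f (x, w)‖ ≤ B w := by
  obtain ⟨p, hp⟩ := Measure.HasTemperateGrowth.exists_integrable (μ := μ)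
  let C := 2 ^ p * ((Finset.Iic (p, 0)).sup (schwartzSeminormFamily ℝ (X × W) E)) f
  refine ⟨fun w => (1 + ‖w‖) ^ (-(p : ℝ)) * C, hp.mul_const C, fun x w => ?_⟩
  beta_reduce
  rw [Real.rpow_neg (by positivity), ← div_eq_inv_mul, le_div_iff₀' (by positivity),
    Real.rpow_natCast]
  calc (1 + ‖w‖) ^ p * ‖f (x, w)‖
      ≤ (1 + ‖(x, w)‖) ^ p * ‖iteratedFDeriv ℝ 0 f (x, w)‖ := by
        rw [norm_iteratedFDeriv_zero]
        gcongr
        exact norm_snd_le (x, w)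
    _ ≤ C := SchwartzMap.one_add_le_sup_seminorm_apply (𝕜 := ℝ) (m := (p, 0)) le_rfl le_rfl f _

end Slices

section PartialFourier

universe u

variable {X W E Z : Type u} [NormedAddCommGroup X] [NormedSpace ℝ X]
  [NormedAddCommGroup W] [InnerProductSpace ℝ W] [NormedAddCommGroup E] [NormedSpace ℂ E]
  [NormedAddCommGroup Z] [NormedSpace ℝ Z]

/-- The operator `D` for which the derivative of `∫ e^(-2πi w·B z) f(A z, w) dw` in `z` is
`∫ e^(-2πi w·B z) (D f)(A z, w) dw`. -/
def partialFourierDeriv (E : Type u) [NormedAddCommGroup E] [NormedSpace ℂ E] (A : Z →L[ℝ] X)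
    (B : Z →L[ℝ] W) : 𝓢(X × W, E) →L[ℝ] 𝓢(X × W, Z →L[ℝ] E) :=
  (SchwartzMap.postcompCLM ((ContinuousLinearMap.compL ℝ Z (X × W) E).flip
      ((ContinuousLinearMap.inl ℝ X W).comp A))).comp (SchwartzMap.fderivCLM ℝ (X × W) E) +
  (-(2 * Real.pi * Complex.I)) • SchwartzMap.smulRightCLM ℝ E
    ((innerSL ℝ (E := W)).bilinearComp (ContinuousLinearMap.snd ℝ X W) B)

theorem partialFourierDeriv_apply (A : Z →L[ℝ] X) (B : Z →L[ℝ] W) (f : 𝓢(X × W, E)) (y : X × W)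
    (v : Z) :
    partialFourierDeriv E A B f y v = fderiv ℝ f y (A v, 0) -
      (2 * Real.pi * Complex.I * inner ℝ y.2 (B v)) • f y := by
  have h : (inner ℝ y.2 (B v) : ℝ) • f y = (inner ℝ y.2 (B v) : ℂ) • f y :=
    (Complex.coe_smul _ _).symm
  rw [mul_smul, ← h, sub_eq_add_neg, ← neg_smul]
  rfl

theorem hasFDerivAt_fourierChar_smul_slice (A : Z →L[ℝ] X) (B : Z →L[ℝ] W) (f : 𝓢(X × W, E))
    (w : W) (z : Z) :
    HasFDerivAt (fun z => (Real.fourierChar (-inner ℝ w (B z)) : ℂ) • f (A z, w))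
      ((Real.fourierChar (-inner ℝ w (B z)) : ℂ) • partialFourierDeriv E A B f (A z, w)) z := by
  have hf : HasFDerivAt (fun z => f (A z, w))
      ((fderiv ℝ f (A z, w)).comp ((ContinuousLinearMap.inl ℝ X W).comp A)) z := by
    have hz : HasFDerivAt (fun z => (A z, w)) ((ContinuousLinearMap.inl ℝ X W).comp A) z := by
      convert! A.hasFDerivAt.prodMk (hasFDerivAt_const w z) using 1
    exact (f.differentiableAt.hasFDerivAt (x := (A z, w))).comp z hz
  have hinner : HasFDerivAt (fun z => -inner ℝ w (B z)) (-((innerSL ℝ w).comp B)) z :=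
    ((innerSL ℝ w).comp B).hasFDerivAt.neg
  have hchar := (Real.hasDerivAt_fourierChar (-inner ℝ w (B z))).hasFDerivAt.comp z hinner
  refine (hchar.smul hf).congr_fderiv (ContinuousLinearMap.ext fun v => ?_)
  have hscalar (r : ℝ) (c : ℂ) : c • (2 * Real.pi * Complex.I * r) • f (A z, w) =
      (r * (2 * Real.pi * Complex.I * c)) • f (A z, w) := by
    rw [smul_smul]
    congr 1
    ring
  rw [smul_apply, partialFourierDeriv_apply, smul_sub, hscalar]
  simp [sub_eq_add_neg]

variable [MeasurableSpace W] [BorelSpace W] [FiniteDimensional ℝ W]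

theorem integrable_fourierChar_smul_slice (f : 𝓢(X × W, E)) (x : X) (ξ : W) :
    Integrable fun w => (Real.fourierChar (-inner ℝ w ξ) : ℂ) • f (x, w) :=
  (Real.fourierIntegral_convergent_iff ξ).2 (slice x f).integrable

/-- The Fourier transform in the second variable, as a function. -/
def partialFourierFun (f : 𝓢(X × W, E)) (x : X) (ξ : W) : E :=
  ∫ w, (Real.fourierChar (-inner ℝ w ξ) : ℂ) • f (x, w)

theorem partialFourierFun_eq_fourier_slice (f : 𝓢(X × W, E)) (x : X) (ξ : W) :
    partialFourierFun f x ξ = 𝓕 (slice x f) ξ := by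
  rw [SchwartzMap.fourier_coe, Real.fourier_eq]
  rfl

theorem hasFDerivAt_partialFourierFun (A : Z →L[ℝ] X) (B : Z →L[ℝ] W) (f : 𝓢(X × W, E)) (z : Z) :
    HasFDerivAt (fun z => partialFourierFun f (A z) (B z))
      (partialFourierFun (partialFourierDeriv E A B f) (A z) (B z)) z := by
  obtain ⟨b, hb, hbf⟩ := exists_integrable_norm_slice_le volume (partialFourierDeriv E A B f)
  refine hasFDerivAt_integral_of_dominated_of_fderiv_le (μ := volume) (bound := b)
    (F := fun z w => (Real.fourierChar (-inner ℝ w (B z)) : ℂ) • f (A z, w))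
    (F' := fun z w =>
      (Real.fourierChar (-inner ℝ w (B z)) : ℂ) • partialFourierDeriv E A B f (A z, w))
    univ_mem ?_ (integrable_fourierChar_smul_slice f _ _)
    (integrable_fourierChar_smul_slice _ _ _).1 ?_ hb ?_
  · exact Eventually.of_forall fun z => (integrable_fourierChar_smul_slice f _ _).1
  · exact Eventually.of_forall fun w z _ =>
      (Circle.norm_smul (Real.fourierChar _) _).trans_le (hbf _ w)
  · exact Eventually.of_forall fun w z _ => hasFDerivAt_fourierChar_smul_slice A B f w z

theorem contDiff_partialFourierFun (A : Z →L[ℝ] X) (B : Z →L[ℝ] W) (f : 𝓢(X × W, E)) (k : ℕ) :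
    ContDiff ℝ k fun z => partialFourierFun f (A z) (B z) := by
  induction k generalizing E with
  | zero =>
    rw [Nat.cast_zero, contDiff_zero]
    exact continuous_iff_continuousAt.2 fun z =>
      (hasFDerivAt_partialFourierFun A B f z).continuousAt
  | succ k ih =>
    rw [Nat.cast_succ, contDiff_succ_iff_hasFDerivAt]
    exact ⟨_, ih (partialFourierDeriv E A B f), hasFDerivAt_partialFourierFun A B f⟩

variable (X W E) in
theorem exists_seminorm_norm_partialFourierFun_le (l m : ℕ) :
    ∃ p : Seminorm ℝ 𝓢(X × W, E), Continuous p ∧ ∀ f x ξ,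
      ‖x‖ ^ l * ‖ξ‖ ^ m * ‖partialFourierFun f x ξ‖ ≤ p f := by
  let T : 𝓢(W, E) →L[ℝ] 𝓢(W, E) := FourierTransform.fourierCLM ℝ 𝓢(W, E)
  let q : Seminorm ℝ 𝓢(W, E) := (SchwartzMap.seminorm ℝ m 0).comp T.toLinearMap
  have hq : Continuous q :=
    ((schwartz_withSeminorms ℝ W E).continuous_seminorm (m, 0)).comp T.continuous
  obtain ⟨p, hp, hpq⟩ := exists_seminorm_slice_le (X := X) hq l
  refine ⟨p, hp, fun f x ξ => le_trans ?_ (hpq f x)⟩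
  rw [mul_assoc, partialFourierFun_eq_fourier_slice]
  gcongr
  exact SchwartzMap.norm_pow_mul_le_seminorm ℝ (T (slice x f)) m ξ

variable (E) in
theorem exists_seminorm_iteratedFDeriv_partialFourierFun_le (A : Z →L[ℝ] X) (B : Z →L[ℝ] W)
    (l m k : ℕ) : ∃ p : Seminorm ℝ 𝓢(X × W, E), Continuous p ∧ ∀ f z,
      ‖A z‖ ^ l * ‖B z‖ ^ m *
        ‖iteratedFDeriv ℝ k (fun z => partialFourierFun f (A z) (B z)) z‖ ≤ p f := by
  induction k generalizing E with
  | zero =>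
    obtain ⟨p, hp, hpf⟩ := exists_seminorm_norm_partialFourierFun_le X W E l m
    exact ⟨p, hp, fun f z => by rw [norm_iteratedFDeriv_zero]; exact hpf f (A z) (B z)⟩
  | succ k ih =>
    obtain ⟨p, hp, hpf⟩ := ih (Z →L[ℝ] E)
    let D : 𝓢(X × W, E) →L[ℝ] 𝓢(X × W, Z →L[ℝ] E) := partialFourierDeriv E A B
    refine ⟨p.comp D.toLinearMap, hp.comp D.continuous, fun f z => ?_⟩
    rw [← norm_iteratedFDeriv_fderiv,
      funext fun z => (hasFDerivAt_partialFourierFun A B f z).fderiv]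
    exact hpf (D f) z

variable (X W E) in
theorem exists_seminorm_pow_mul_iteratedFDeriv_partialFourierFun_le (j k : ℕ) :
    ∃ p : Seminorm ℝ 𝓢(X × W, E), Continuous p ∧ ∀ f z,
      ‖z‖ ^ j * ‖iteratedFDeriv ℝ k (fun z : X × W => partialFourierFun f z.1 z.2) z‖ ≤ p f := by
  obtain ⟨p, hp, hpf⟩ := exists_seminorm_iteratedFDeriv_partialFourierFun_le E
    (.fst ℝ X W) (.snd ℝ X W) j 0 k
  obtain ⟨q, hq, hqf⟩ := exists_seminorm_iteratedFDeriv_partialFourierFun_le E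
    (.fst ℝ X W) (.snd ℝ X W) 0 j k
  refine ⟨p ⊔ q, hp.sup hq, fun f z => ?_⟩
  rcases max_choice ‖z.1‖ ‖z.2‖ with h | h <;> rw [Prod.norm_def, h]
  · exact le_sup_of_le_left (by simpa using hpf f z)
  · exact le_sup_of_le_right (by simpa using hqf f z)

/-- The Fourier transform in the second variable, as an operator on Schwartz functions. -/
def partialFourier : 𝓢(X × W, E) →L[ℝ] 𝓢(X × W, E) :=
  SchwartzMap.mkCLM (𝕜 := ℝ) (𝕜' := ℝ) (σ := .id ℝ) (fun f z => partialFourierFun f z.1 z.2)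
    (fun f g z => by
      simp only [partialFourierFun_eq_fourier_slice, map_add, FourierTransform.fourier_add,
        add_apply])
    (fun a f z => by
      simp only [partialFourierFun_eq_fourier_slice, map_smul, FourierTransform.fourier_smul,
        smul_apply, RingHom.id_apply])
    (fun f => contDiff_infty.2 (contDiff_partialFourierFun (.fst ℝ X W) (.snd ℝ X W) f))
    (fun ⟨j, k⟩ => by
      obtain ⟨p, hp, hpf⟩ := exists_seminorm_pow_mul_iteratedFDeriv_partialFourierFun_le X W E j k
      obtain ⟨s, C, -, hC⟩ := Seminorm.bound_of_continuous (schwartz_withSeminorms ℝ _ _) p hp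
      exact ⟨s, C, C.2, fun f z => (hpf f z).trans (hC f)⟩)

theorem partialFourier_apply (f : 𝓢(X × W, E)) (z : X × W) :
    partialFourier f z = ∫ w, (Real.fourierChar (-inner ℝ w z.2) : ℂ) • f (z.1, w) := rfl

@[simp]
theorem slice_partialFourier (f : 𝓢(X × W, E)) (x : X) :
    slice x (partialFourier f) = 𝓕 (slice x f) :=
  SchwartzMap.ext fun ξ => partialFourierFun_eq_fourier_slice f x ξ

end PartialFourier

section InverseAndMarginal

universe u

variable {X W E : Type u} [NormedAddCommGroup X] [NormedSpace ℝ X] [NormedAddCommGroup W]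
  [InnerProductSpace ℝ W] [FiniteDimensional ℝ W] [MeasurableSpace W] [BorelSpace W]
  [NormedAddCommGroup E] [NormedSpace ℂ E]

/-- The inverse Fourier transform in the second variable. -/
def partialFourierInv : 𝓢(X × W, E) →L[ℝ] 𝓢(X × W, E) :=
  (SchwartzMap.compCLMOfContinuousLinearEquiv ℝ
    ((ContinuousLinearEquiv.refl ℝ X).prodCongr (.neg ℝ))).comp partialFourier

@[simp]
theorem slice_partialFourierInv (f : 𝓢(X × W, E)) (x : X) :
    slice x (partialFourierInv f) = 𝓕⁻ (slice x f) := by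
  ext ξ
  rw [SchwartzMap.fourierInv_coe, Real.fourierInv_eq_fourier_neg, ← SchwartzMap.fourier_coe,
    ← slice_partialFourier]
  rfl

/-- The Fourier transform in the second variable, as an equivalence. -/
def partialFourierEquiv [CompleteSpace E] : 𝓢(X × W, E) ≃L[ℝ] 𝓢(X × W, E) :=
  .equivOfInverse partialFourier partialFourierInv
    (fun f => ext_slice fun x => by simp) (fun f => ext_slice fun x => by simp)

/-- Integration over the second variable, that is, the partial Fourier transform at frequency
zero. -/
def marginal : 𝓢(X × W, E) →L[ℝ] 𝓢(X, E) :=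
  (SchwartzMap.compCLMOfAntilipschitz ℝ (ContinuousLinearMap.inl ℝ X W).hasTemperateGrowth
    (AntilipschitzWith.of_le_mul_dist (K := 1) fun x x' => by simp [Prod.dist_eq])).comp
  partialFourier

theorem marginal_apply (f : 𝓢(X × W, E)) (x : X) : marginal f x = ∫ w, f (x, w) := by
  change partialFourier f (x, 0) = _
  simp only [partialFourier_apply, inner_zero_right, neg_zero, AddChar.map_zero_eq_one,
    Circle.coe_one, one_smul]

end InverseAndMarginal

section KernelOfSymbol

variable {W : Type} [NormedAddCommGroup W] [InnerProductSpace ℝ W] [FiniteDimensional ℝ W]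
  [MeasurableSpace W] [BorelSpace W]

/-- Composition of Schwartz functions with an invertible linear map, as an equivalence. -/
def compEquiv {V V' : Type*} [NormedAddCommGroup V] [NormedSpace ℝ V] [NormedAddCommGroup V']
    [NormedSpace ℝ V'] (g : V ≃L[ℝ] V') : 𝓢(V', ℂ) ≃L[ℝ] 𝓢(V, ℂ) :=
  .equivOfInverse (SchwartzMap.compCLMOfContinuousLinearEquiv ℝ g)
    (SchwartzMap.compCLMOfContinuousLinearEquiv ℝ g.symm) (fun f => by ext; simp)
    (fun f => by ext; simp)

variable (W) in
/-- The map `(x, η) ↦ (x, 2πη)`, which turns the kernel `e^(-2πi v·η)` of Mathlib's Fourier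
transform into `e^(-i v·ξ)`. -/
def twoPiScaling : (W × W) ≃L[ℝ] W × W :=
  (ContinuousLinearEquiv.refl ℝ W).prodCongr (.smulLeft (Units.mk0 _ Real.two_pi_pos.ne'))

variable (W) in
/-- The map `(x, y) ↦ (x, y - x)`. -/
def differenceShear : (W × W) ≃L[ℝ] W × W :=
  (ContinuousLinearEquiv.refl ℝ W).skewProd (.refl ℝ W) (-.id ℝ W)

/-- The correspondence between the symbol `a` of a pseudo-differential operator and its kernel
`(2π)^(-n) ∫ e^(i(x-y)·ξ) a(x,ξ) dξ`. -/
def kernelOfSymbol : 𝓢(W × W, ℂ) ≃L[ℝ] 𝓢(W × W, ℂ) :=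
  ((compEquiv (twoPiScaling W)).trans partialFourierEquiv).trans (compEquiv (differenceShear W))

theorem fourierChar_eq_cexp (t : ℝ) :
    (Real.fourierChar t : ℂ) = Complex.exp (Complex.I * ((2 * Real.pi * t : ℝ) : ℂ)) := by
  rw [Real.fourierChar_apply, mul_comm Complex.I]

theorem kernelOfSymbol_apply (a : 𝓢(W × W, ℂ)) (x y : W) :
    kernelOfSymbol a (x, y) = (((2 * Real.pi) ^ Module.finrank ℝ W)⁻¹ : ℝ) *
      ∫ ξ, Complex.exp (Complex.I * (inner ℝ (x - y) ξ : ℝ)) * a (x, ξ) := by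
  have hscale := Measure.integral_comp_smul (volume : Measure W)
    (fun ξ => Complex.exp (Complex.I * (inner ℝ (x - y) ξ : ℝ)) * a (x, ξ)) (2 * Real.pi)
  rw [abs_of_nonneg (by positivity), Complex.real_smul] at hscale
  have hphase (v : W) : 2 * Real.pi * -inner ℝ v (y + -x) =
      inner ℝ (x - y) ((2 * Real.pi) • v) := by
    rw [real_inner_smul_right, real_inner_comm, ← sub_eq_add_neg, ← inner_neg_left, neg_sub]
  calc kernelOfSymbol a (x, y)
      = ∫ v, (Real.fourierChar (-inner ℝ v (y + -x)) : ℂ) • a (x, (2 * Real.pi) • v) := rfl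
    _ = _ := by simp_rw [← hscale, fourierChar_eq_cexp, hphase, smul_eq_mul]

end KernelOfSymbol

section SchwartzNets

variable {V V' : Type*} [NormedAddCommGroup V] [NormedSpace ℝ V] [NormedAddCommGroup V']
  [NormedSpace ℝ V']

/-- The net `U_ε` of Schwartz functions is of the order of `r_ε`: every continuous seminorm of
`U_ε` is bounded by a multiple of `r_ε`, uniformly in `ε`. -/
def IsOfOrder (U : Eps → 𝓢(V, ℂ)) (r : Eps → ℝ) : Prop :=
  ∀ p : Seminorm ℝ 𝓢(V, ℂ), Continuous p → ∃ C, ∀ ε, p (U ε) ≤ C * r ε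

theorem isOfOrder_iff {U : Eps → 𝓢(V, ℂ)} {r : Eps → ℝ} (hr : ∀ ε, 0 ≤ r ε) :
    IsOfOrder U r ↔ ∀ j k : ℕ, ∃ C : ℝ, ∀ ε x,
      ‖x‖ ^ j * ‖iteratedFDeriv ℝ k (U ε) x‖ ≤ C * r ε := by
  refine ⟨fun h j k => ?_, fun h p hp => ?_⟩
  · obtain ⟨C, hC⟩ := h _ ((schwartz_withSeminorms ℝ V ℂ).continuous_seminorm (j, k))
    exact ⟨C, fun ε x => (SchwartzMap.le_seminorm ℝ j k (U ε) x).trans (hC ε)⟩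
  · obtain ⟨s, B, -, hB⟩ := Seminorm.bound_of_continuous (schwartz_withSeminorms ℝ V ℂ) p hp
    choose C hC using h
    let D : ℝ := ∑ i ∈ s, |C i.1 i.2|
    have hD (ε : Eps) : 0 ≤ D * r ε := mul_nonneg (Finset.sum_nonneg fun _ _ => abs_nonneg _) (hr ε)
    have hs (ε : Eps) : s.sup (schwartzSeminormFamily ℝ V ℂ) (U ε) ≤ D * r ε := by
      refine Seminorm.finset_sup_apply_le (hD ε) fun i hi => ?_
      refine SchwartzMap.seminorm_le_bound ℝ i.1 i.2 _ (hD ε) fun x => (hC i.1 i.2 ε x).trans ?_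
      exact mul_le_mul_of_nonneg_right ((le_abs_self _).trans
        (Finset.single_le_sum (f := fun i => |C i.1 i.2|) (fun _ _ => abs_nonneg _) hi)) (hr ε)
    exact ⟨B * D, fun ε => (hB (U ε)).trans
      ((mul_le_mul_of_nonneg_left (hs ε) B.2).trans_eq (mul_assoc _ _ _).symm)⟩

theorem IsOfOrder.map {U : Eps → 𝓢(V, ℂ)} {r : Eps → ℝ} (hU : IsOfOrder U r)
    (T : 𝓢(V, ℂ) →L[ℝ] 𝓢(V', ℂ)) : IsOfOrder (fun ε => T (U ε)) r := fun p hp =>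
  hU (p.comp T.toLinearMap) (hp.comp T.continuous)

theorem isSRegularNet_coe_iff {U : Eps → 𝓢(V, ℂ)} :
    IsSRegularNet (fun ε => ⇑(U ε)) ↔ ∃ N : ℕ, IsOfOrder U fun ε => ((ε : ℝ) ^ N)⁻¹ := by
  have hr (N : ℕ) (ε : Eps) : 0 < (ε : ℝ) ^ N := pow_pos ε.2.1 N
  simp only [isOfOrder_iff fun ε => (inv_pos.2 (hr _ ε)).le, ← div_eq_mul_inv,
    le_div_iff₀' (hr _ _)]
  exact and_iff_right fun ε => (U ε).smooth ⊤

theorem coe_mem_negligible_iff {U : Eps → 𝓢(V, ℂ)} :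
    (fun ε => ⇑(U ε)) ∈ Negligible V ↔ ∀ q : ℕ, IsOfOrder U fun ε => (ε : ℝ) ^ q := by
  simp only [isOfOrder_iff fun ε => pow_nonneg ε.2.1.le _]
  exact (and_iff_right fun ε => (U ε).smooth ⊤).trans
    ⟨fun h q j k => h j k q, fun h j k q => h q j k⟩

theorem SmoothNets.exists_eq_coe {u : Eps → V → ℂ} (hu : u ∈ SmoothNets V)
    (h : ∀ (ε : Eps) (j k : ℕ), ∃ C : ℝ, ∀ x, ‖x‖ ^ j * ‖iteratedFDeriv ℝ k (u ε) x‖ ≤ C) :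
    ∃ U : Eps → 𝓢(V, ℂ), u = fun ε => ⇑(U ε) :=
  ⟨fun ε => ⟨u ε, hu ε, h ε⟩, rfl⟩

theorem IsSRegularNet.exists_eq_coe {u : Eps → V → ℂ} (hu : IsSRegularNet u) :
    ∃ U : Eps → 𝓢(V, ℂ), u = fun ε => ⇑(U ε) := by
  obtain ⟨hs, N, hN⟩ := hu
  refine SmoothNets.exists_eq_coe hs fun ε j k => ?_
  obtain ⟨C, hC⟩ := hN j k
  exact ⟨C / (ε : ℝ) ^ N, fun x => (le_div_iff₀' (pow_pos ε.2.1 N)).2 (hC ε x)⟩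

theorem exists_eq_coe_of_mem_negligible {u : Eps → V → ℂ} (hu : u ∈ Negligible V) :
    ∃ U : Eps → 𝓢(V, ℂ), u = fun ε => ⇑(U ε) := by
  refine SmoothNets.exists_eq_coe hu.1 fun ε j k => ?_
  obtain ⟨C, hC⟩ := hu.2 j k 0
  exact ⟨C * (ε : ℝ) ^ 0, hC ε⟩

theorem IsSRegularNet.map {U : Eps → 𝓢(V, ℂ)} (hU : IsSRegularNet fun ε => ⇑(U ε))
    (T : 𝓢(V, ℂ) →L[ℝ] 𝓢(V', ℂ)) : IsSRegularNet fun ε => ⇑(T (U ε)) := by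
  obtain ⟨N, hN⟩ := isSRegularNet_coe_iff.1 hU
  exact isSRegularNet_coe_iff.2 ⟨N, hN.map T⟩

theorem map_mem_negligible {U : Eps → 𝓢(V, ℂ)} (hU : (fun ε => ⇑(U ε)) ∈ Negligible V)
    (T : 𝓢(V, ℂ) →L[ℝ] 𝓢(V', ℂ)) : (fun ε => ⇑(T (U ε))) ∈ Negligible V' :=
  coe_mem_negligible_iff.2 fun q => (coe_mem_negligible_iff.1 hU q).map T

theorem IsSRegularNet.mem_tempered {u : Eps → V → ℂ} (hu : IsSRegularNet u) : u ∈ Tempered V := by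
  obtain ⟨hs, N, hN⟩ := hu
  refine ⟨hs, fun k => ?_⟩
  obtain ⟨C, hC⟩ := hN 0 k
  refine ⟨N, |C|, fun ε x => ?_⟩
  have hCε : (ε : ℝ) ^ N * ‖iteratedFDeriv ℝ k (u ε) x‖ ≤ C := by simpa using hC ε x
  exact (hCε.trans (le_abs_self C)).trans
    (le_mul_of_one_le_right (abs_nonneg C) (one_le_pow₀ (one_le_bracket x)))

end SchwartzNets

section TemperedNets

theorem bracket_le_one_add_norm {V : Type*} [NormedAddCommGroup V] (x : V) :
    bracket x ≤ 1 + ‖x‖ := by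
  refine Real.sqrt_le_iff.2 ⟨by positivity, ?_⟩
  nlinarith [norm_nonneg x]

variable {V V' : Type*} [NormedAddCommGroup V] [NormedSpace ℝ V] [NormedAddCommGroup V']
  [NormedSpace ℝ V']

theorem exists_forall_le_pow_mul_norm_iteratedFDeriv_le {u : Eps → V → ℂ} (hu : u ∈ Tempered V)
    (k : ℕ) : ∃ (N : ℕ) (C : ℝ), 0 ≤ C ∧ ∀ i ≤ k, ∀ (ε : Eps) x,
      (ε : ℝ) ^ N * ‖iteratedFDeriv ℝ i (u ε) x‖ ≤ C * (1 + ‖x‖) ^ N := by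
  choose N C hNC using hu.2
  let M := ∑ i ∈ Finset.range (k + 1), N i
  let D := ∑ i ∈ Finset.range (k + 1), |C i|
  refine ⟨M, D, Finset.sum_nonneg fun _ _ => abs_nonneg _, fun i hi ε x => ?_⟩
  have hmem : i ∈ Finset.range (k + 1) := Finset.mem_range_succ_iff.2 hi
  have hM : N i ≤ M := Finset.single_le_sum (f := N) (fun _ _ => Nat.zero_le _) hmem
  have hD : |C i| ≤ D := Finset.single_le_sum (f := fun i => |C i|) (fun _ _ => abs_nonneg _) hmem
  have hb : 0 ≤ bracket x := zero_le_one.trans (one_le_bracket x)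
  calc (ε : ℝ) ^ M * ‖iteratedFDeriv ℝ i (u ε) x‖
      ≤ (ε : ℝ) ^ N i * ‖iteratedFDeriv ℝ i (u ε) x‖ := by
        gcongr ?_ * _
        exact pow_le_pow_of_le_one ε.2.1.le ε.2.2 hM
    _ ≤ C i * bracket x ^ N i := hNC i ε x
    _ ≤ |C i| * bracket x ^ N i := by gcongr; exact le_abs_self _
    _ ≤ D * (1 + ‖x‖) ^ N i := by gcongr; exact bracket_le_one_add_norm x
    _ ≤ D * (1 + ‖x‖) ^ M := by gcongr; simp

theorem hasTemperateGrowth_of_mem_tempered {u : Eps → V → ℂ} (hu : u ∈ Tempered V) (ε : Eps) :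
    (u ε).HasTemperateGrowth := by
  refine ⟨hu.1 ε, fun k => ?_⟩
  obtain ⟨N, C, -, h⟩ := exists_forall_le_pow_mul_norm_iteratedFDeriv_le hu k
  refine ⟨N, C / (ε : ℝ) ^ N, fun x => ?_⟩
  rw [div_mul_eq_mul_div, le_div_iff₀' (pow_pos ε.2.1 N)]
  exact h k le_rfl ε x

theorem exists_norm_iteratedFDeriv_mul_norm_iteratedFDeriv_le {u : Eps → V → ℂ}
    (hu : u ∈ Tempered V) (j k : ℕ) : ∃ (N : ℕ) (D : ℝ) (p : Seminorm ℝ 𝓢(V, ℂ)), 0 ≤ D ∧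
      Continuous p ∧ ∀ i ≤ k, ∀ l ≤ k, ∀ (ε : Eps) (f : 𝓢(V, ℂ)) x, (ε : ℝ) ^ N *
        (‖x‖ ^ j * (‖iteratedFDeriv ℝ i (u ε) x‖ * ‖iteratedFDeriv ℝ l f x‖)) ≤ D * p f := by
  obtain ⟨N, C, hC, h⟩ := exists_forall_le_pow_mul_norm_iteratedFDeriv_le hu k
  let p := (Finset.Iic (N + j, k)).sup (schwartzSeminormFamily ℝ V ℂ)
  refine ⟨N, C * 2 ^ (N + j), p, by positivity, Seminorm.continuous_finsetSup fun i _ =>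
    (schwartz_withSeminorms ℝ V ℂ).continuous_seminorm i, fun i hi l hl ε f x => ?_⟩
  have hu' := h i hi ε x
  have hx : ‖x‖ ^ j ≤ (1 + ‖x‖) ^ j := by gcongr; linarith
  have hf : (1 + ‖x‖) ^ (N + j) * ‖iteratedFDeriv ℝ l f x‖ ≤ 2 ^ (N + j) * p f :=
    SchwartzMap.one_add_le_sup_seminorm_apply (𝕜 := ℝ) (m := (N + j, k)) le_rfl hl f x
  calc (ε : ℝ) ^ N * (‖x‖ ^ j * (‖iteratedFDeriv ℝ i (u ε) x‖ * ‖iteratedFDeriv ℝ l f x‖))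
      = ((ε : ℝ) ^ N * ‖iteratedFDeriv ℝ i (u ε) x‖) *
          (‖x‖ ^ j * ‖iteratedFDeriv ℝ l f x‖) := by ring
    _ ≤ (C * (1 + ‖x‖) ^ N) * ((1 + ‖x‖) ^ j * ‖iteratedFDeriv ℝ l f x‖) :=
        mul_le_mul hu' (mul_le_mul_of_nonneg_right hx (norm_nonneg _)) (by positivity)
          (by positivity)
    _ = C * ((1 + ‖x‖) ^ (N + j) * ‖iteratedFDeriv ℝ l f x‖) := by ring
    _ ≤ C * (2 ^ (N + j) * p f) := mul_le_mul_of_nonneg_left hf hC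
    _ = C * 2 ^ (N + j) * p f := by ring

theorem exists_pow_mul_norm_iteratedFDeriv_mul_le {u : Eps → V → ℂ} (hu : u ∈ Tempered V)
    (j k : ℕ) : ∃ (N : ℕ) (D : ℝ) (p : Seminorm ℝ 𝓢(V, ℂ)), 0 ≤ D ∧ Continuous p ∧
      ∀ (ε : Eps) (f : 𝓢(V, ℂ)) x,
        (ε : ℝ) ^ N * (‖x‖ ^ j * ‖iteratedFDeriv ℝ k (u ε * ⇑f) x‖) ≤ D * p f := by
  obtain ⟨N, D, p, hD, hp, h⟩ := exists_norm_iteratedFDeriv_mul_norm_iteratedFDeriv_le hu j k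
  refine ⟨N, ∑ i ∈ Finset.range (k + 1), k.choose i * D, p, by positivity, hp, fun ε f x => ?_⟩
  have hε := ε.2.1
  calc (ε : ℝ) ^ N * (‖x‖ ^ j * ‖iteratedFDeriv ℝ k (u ε * ⇑f) x‖)
      ≤ (ε : ℝ) ^ N * (‖x‖ ^ j * ∑ i ∈ Finset.range (k + 1), k.choose i *
          ‖iteratedFDeriv ℝ i (u ε) x‖ * ‖iteratedFDeriv ℝ (k - i) f x‖) := by
        gcongr
        exact norm_iteratedFDeriv_mul_le (hu.1 ε) (f.smooth ⊤) x (mod_cast le_top)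
    _ = ∑ i ∈ Finset.range (k + 1), k.choose i * ((ε : ℝ) ^ N * (‖x‖ ^ j *
          (‖iteratedFDeriv ℝ i (u ε) x‖ * ‖iteratedFDeriv ℝ (k - i) f x‖))) := by
        rw [Finset.mul_sum, Finset.mul_sum]
        exact Finset.sum_congr rfl fun i _ => by ring
    _ ≤ ∑ i ∈ Finset.range (k + 1), k.choose i * (D * p f) :=
        Finset.sum_le_sum fun i hi => mul_le_mul_of_nonneg_left
          (h i (Finset.mem_range_succ_iff.1 hi) (k - i) (Nat.sub_le k i) ε f x) (Nat.cast_nonneg _)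
    _ = _ := by simp_rw [← mul_assoc, Finset.sum_mul]

theorem mul_mem_negligible {u f : Eps → V → ℂ} (hu : u ∈ Tempered V) (hf : f ∈ Negligible V) :
    u * f ∈ Negligible V := by
  obtain ⟨F, rfl⟩ := exists_eq_coe_of_mem_negligible hf
  refine ⟨fun ε => (hu.1 ε).mul ((F ε).smooth ⊤), fun j k q => ?_⟩
  obtain ⟨N, D, p, hD, hp, hpu⟩ := exists_pow_mul_norm_iteratedFDeriv_mul_le hu j k
  obtain ⟨C, hC⟩ := coe_mem_negligible_iff.1 hf (q + N) p hp
  refine ⟨D * C, fun ε x => le_of_mul_le_mul_left ?_ (pow_pos ε.2.1 N)⟩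
  calc (ε : ℝ) ^ N * (‖x‖ ^ j * ‖iteratedFDeriv ℝ k (u ε * ⇑(F ε)) x‖)
      ≤ D * p (F ε) := hpu ε (F ε) x
    _ ≤ D * (C * (ε : ℝ) ^ (q + N)) := mul_le_mul_of_nonneg_left (hC ε) hD
    _ = (ε : ℝ) ^ N * (D * C * (ε : ℝ) ^ q) := by ring

theorem comp_mem_tempered {u : Eps → V' → ℂ} (hu : u ∈ Tempered V') {L : Eps → V →L[ℝ] V'}
    (hL : ∀ ε, ‖L ε‖ ≤ 1) : (fun ε x => u ε (L ε x)) ∈ Tempered V := by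
  refine ⟨fun ε => ContDiff.comp (hu.1 ε) (L ε).contDiff, fun k => ?_⟩
  obtain ⟨N, C, h⟩ := hu.2 k
  refine ⟨N, |C|, fun ε x => ?_⟩
  have hLx : ‖L ε x‖ ≤ ‖x‖ := ((L ε).le_of_opNorm_le (hL ε) x).trans_eq (one_mul _)
  have hd : ‖iteratedFDeriv ℝ k (u ε ∘ L ε) x‖ ≤ ‖iteratedFDeriv ℝ k (u ε) (L ε x)‖ := by
    rw [(L ε).iteratedFDeriv_comp_right (hu.1 ε) x (mod_cast le_top)]
    refine (ContinuousMultilinearMap.norm_compContinuousLinearMap_le _ _).trans ?_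
    exact mul_le_of_le_one_right (norm_nonneg _)
      (Finset.prod_le_one (fun _ _ => norm_nonneg _) fun _ _ => hL ε)
  have hb : bracket (L ε x) ≤ bracket x := by unfold bracket; gcongr
  have hb0 : 0 ≤ bracket (L ε x) := zero_le_one.trans (one_le_bracket _)
  have hε := ε.2.1
  calc (ε : ℝ) ^ N * ‖iteratedFDeriv ℝ k (u ε ∘ L ε) x‖
      ≤ (ε : ℝ) ^ N * ‖iteratedFDeriv ℝ k (u ε) (L ε x)‖ := by gcongr
    _ ≤ |C| * bracket (L ε x) ^ N := (h ε (L ε x)).trans (by gcongr; exact le_abs_self C)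
    _ ≤ |C| * bracket x ^ N := by gcongr

end TemperedNets

section KernelAction

variable {n : ℕ}

theorem scaledHat_eq_fourier (φ : 𝓢(Rn n, ℂ)) (ε : Eps) (y : Rn n) :
    scaledHat φ ε y = 𝓕 φ (((2 * Real.pi)⁻¹ * ε) • y) := by
  have hε : (ε : ℝ) ^ n ≠ 0 := pow_ne_zero n ε.2.1.ne'
  have hsubst := Measure.integral_comp_inv_smul (volume : Measure (Rn n))
    (fun x => Complex.exp (-Complex.I * (ε * inner ℝ x y : ℝ)) * φ x) ε
  rw [finrank_euclideanSpace, Fintype.card_fin, abs_of_pos (pow_pos ε.2.1 n)] at hsubst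
  calc scaledHat φ ε y
      = ((ε : ℝ) ^ n)⁻¹ • ∫ x, Complex.exp (-Complex.I *
          (ε * inner ℝ ((ε : ℝ)⁻¹ • x) y : ℝ)) * φ ((ε : ℝ)⁻¹ • x) := by
        rw [← integral_smul]
        refine integral_congr_ae (.of_forall fun x => ?_)
        simp only [scaled, real_inner_smul_left, mul_inv_cancel_left₀ ε.2.1.ne', Complex.real_smul]
        ring
    _ = ∫ x, Complex.exp (-Complex.I * (ε * inner ℝ x y : ℝ)) * φ x := by
        rw [hsubst, inv_smul_smul₀ hε]
    _ = 𝓕 φ (((2 * Real.pi)⁻¹ * ε) • y) := by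
        rw [SchwartzMap.fourier_coe, Real.fourier_eq]
        refine integral_congr_ae (.of_forall fun x => ?_)
        have hphase : 2 * Real.pi * -((2 * Real.pi)⁻¹ * ε * inner ℝ x y) = -(ε * inner ℝ x y) := by
          field_simp
        simp only [Circle.smul_def, fourierChar_eq_cexp, real_inner_smul_right, smul_eq_mul, hphase]
        congr 2
        push_cast
        ring

theorem exists_schwartz_eq_scaledHat (φ : 𝓢(Rn n, ℂ)) (ε : Eps) :
    ∃ g : 𝓢(Rn n, ℂ), ⇑g = scaledHat φ ε := by
  have hc : (2 * Real.pi)⁻¹ * (ε : ℝ) ≠ 0 := mul_ne_zero (inv_ne_zero Real.two_pi_pos.ne') ε.2.1.ne'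
  refine ⟨compEquiv (.smulLeft (Units.mk0 _ hc)) (𝓕 φ), ?_⟩
  ext y
  rw [scaledHat_eq_fourier]
  rfl

theorem scaledHat_mem_tempered (φ : 𝓢(Rn n, ℂ)) : scaledHat φ ∈ Tempered (Rn n) := by
  have hconst : IsSRegularNet fun _ => ⇑(𝓕 φ : 𝓢(Rn n, ℂ)) :=
    isSRegularNet_coe_iff.2 ⟨0, fun p _ => ⟨p (𝓕 φ), fun _ => by simp⟩⟩
  have hnorm (ε : Eps) :
      ‖((2 * Real.pi)⁻¹ * (ε : ℝ)) • ContinuousLinearMap.id ℝ (Rn n)‖ ≤ 1 := by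
    have h2π : (2 * Real.pi)⁻¹ ≤ 1 := inv_le_one_of_one_le₀ (by linarith [Real.pi_gt_three])
    rw [norm_smul, Real.norm_of_nonneg (mul_nonneg (by positivity) ε.2.1.le)]
    exact mul_le_one₀ (mul_le_one₀ h2π ε.2.1.le ε.2.2) (norm_nonneg _)
      ContinuousLinearMap.norm_id_le
  convert comp_mem_tempered hconst.mem_tempered hnorm using 1
  exact funext fun ε => funext fun y => scaledHat_eq_fourier φ ε y

theorem integrable_mul_scaledHat (φ : 𝓢(Rn n, ℂ)) {u : Eps → Rn n → ℂ}
    (hu : u ∈ Tempered (Rn n)) (ε : Eps) : Integrable fun y => u ε y * scaledHat φ ε y := by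
  obtain ⟨g, hg⟩ := exists_schwartz_eq_scaledHat φ ε
  rw [← hg]
  convert (SchwartzMap.smulLeftCLM ℂ (u ε) g).integrable (μ := volume) using 2 with y
  rw [SchwartzMap.smulLeftCLM_apply_apply (hasTemperateGrowth_of_mem_tempered hu ε), smul_eq_mul]

theorem integrable_schwartz_mul_mul_scaledHat (φ : 𝓢(Rn n, ℂ)) {u : Eps → Rn n → ℂ}
    (hu : u ∈ Tempered (Rn n)) (ε : Eps) (f : 𝓢(Rn n, ℂ)) :
    Integrable fun y => f y * u ε y * scaledHat φ ε y := by
  simp only [mul_assoc]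
  exact (integrable_mul_scaledHat φ hu ε).bdd_mul f.continuous.aestronglyMeasurable
    (.of_forall (f.norm_le_seminorm ℝ))

theorem integral_mem_negligible (φ : 𝓢(Rn n, ℂ)) {k : Eps → Rn n × Rn n → ℂ}
    (hk : k ∈ Negligible (Rn n × Rn n)) {u : Eps → Rn n → ℂ} (hu : u ∈ Tempered (Rn n)) :
    (fun ε x => ∫ y, k ε (x, y) * u ε y * scaledHat φ ε y) ∈ Negligible (Rn n) := by
  have hsnd {w : Eps → Rn n → ℂ} (hw : w ∈ Tempered (Rn n)) :
      (fun ε (z : Rn n × Rn n) => w ε z.2) ∈ Tempered (Rn n × Rn n) :=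
    comp_mem_tempered hw fun _ => ContinuousLinearMap.norm_snd_le ℝ (Rn n) (Rn n)
  have hprod := mul_mem_negligible (hsnd (scaledHat_mem_tempered φ))
    (mul_mem_negligible (hsnd hu) hk)
  obtain ⟨F, hF⟩ := exists_eq_coe_of_mem_negligible hprod
  rw [hF] at hprod
  convert map_mem_negligible hprod marginal using 1
  ext ε x
  rw [marginal_apply]
  refine integral_congr_ae (.of_forall fun y => ?_)
  beta_reduce
  rw [← congrFun (congrFun hF ε) (x, y)]
  simp only [Pi.mul_apply]
  ring

end KernelAction

section Weights

/-- `Λ` is bounded above and below by multiples of powers of `1 + ‖z‖`, the exponent of the lower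
bound being positive. Weight functions have this property, which makes powers of `Λ` and powers of
`1 + ‖z‖` interchangeable in estimates of rapid decay. -/
def HasPolynomialBounds {V : Type*} [NormedAddCommGroup V] (Λ : V → ℝ) : Prop :=
  ∃ μ ν c d : ℝ, 0 < μ ∧ 0 < c ∧ 0 < d ∧
    ∀ z, (1 + ‖z‖) ^ μ ≤ c * Λ z ∧ Λ z ≤ d * (1 + ‖z‖) ^ ν

namespace HasPolynomialBounds

variable {V : Type*} [NormedAddCommGroup V] {Λ : V → ℝ}

theorem pos (hΛ : HasPolynomialBounds Λ) (z : V) : 0 < Λ z := by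
  obtain ⟨μ, _, c, _, -, hc, -, h⟩ := hΛ
  exact (mul_pos_iff_of_pos_left hc).1 ((by positivity : 0 < (1 + ‖z‖) ^ μ).trans_le (h z).1)

theorem exists_pow_mul_rpow_le (hΛ : HasPolynomialBounds Λ) (j : ℕ) :
    ∃ m C : ℝ, ∀ z, (1 + ‖z‖) ^ j * Λ z ^ m ≤ C := by
  have hpos := hΛ.pos
  obtain ⟨μ, _, c, _, hμ, hc, -, h⟩ := hΛ
  refine ⟨-(j / μ), c ^ (j / μ), fun z => ?_⟩
  have hz := hpos z
  rw [Real.rpow_neg hz.le, ← div_eq_mul_inv, div_le_iff₀ (by positivity),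
    ← Real.mul_rpow hc.le hz.le]
  calc (1 + ‖z‖) ^ j = ((1 + ‖z‖) ^ μ) ^ (j / μ) := by
        rw [← Real.rpow_mul (by positivity), mul_div_cancel₀ _ hμ.ne', Real.rpow_natCast]
    _ ≤ (c * Λ z) ^ (j / μ) := Real.rpow_le_rpow (by positivity) (h z).1 (by positivity)

theorem exists_rpow_le_mul_pow_of_nonneg (hΛ : HasPolynomialBounds Λ) {s : ℝ} (hs : 0 ≤ s) :
    ∃ (j : ℕ) (C : ℝ), 0 < C ∧ ∀ z, Λ z ^ s ≤ C * (1 + ‖z‖) ^ j := by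
  have hpos := hΛ.pos
  obtain ⟨_, ν, _, d, -, -, hd, h⟩ := hΛ
  obtain ⟨j, hj⟩ := exists_nat_ge (ν * s)
  refine ⟨j, d ^ s, by positivity, fun z => ?_⟩
  have hz : 1 ≤ 1 + ‖z‖ := le_add_of_nonneg_right (norm_nonneg z)
  calc Λ z ^ s ≤ (d * (1 + ‖z‖) ^ ν) ^ s := Real.rpow_le_rpow (hpos z).le (h z).2 hs
    _ = d ^ s * (1 + ‖z‖) ^ (ν * s) := by
        rw [Real.mul_rpow hd.le (by positivity), ← Real.rpow_mul (by positivity)]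
    _ ≤ d ^ s * (1 + ‖z‖) ^ j := by
        rw [← Real.rpow_natCast]
        gcongr

theorem exists_one_le_mul_rpow_of_nonneg (hΛ : HasPolynomialBounds Λ) {s : ℝ} (hs : 0 ≤ s) :
    ∃ C : ℝ, 0 < C ∧ ∀ z, 1 ≤ C * Λ z ^ s := by
  have hpos := hΛ.pos
  obtain ⟨μ, _, c, _, hμ, hc, -, h⟩ := hΛ
  refine ⟨c ^ s, by positivity, fun z => ?_⟩
  rw [← Real.mul_rpow hc.le (hpos z).le]
  have hz : 1 ≤ (1 + ‖z‖) ^ μ :=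
    Real.one_le_rpow (le_add_of_nonneg_right (norm_nonneg z)) hμ.le
  exact Real.one_le_rpow (hz.trans (h z).1) hs

theorem exists_one_le_mul_rpow (hΛ : HasPolynomialBounds Λ) (s : ℝ) :
    ∃ (j : ℕ) (C : ℝ), 0 < C ∧ ∀ z, 1 ≤ C * (1 + ‖z‖) ^ j * Λ z ^ s := by
  rcases le_total 0 s with hs | hs
  · obtain ⟨C, hC, h⟩ := hΛ.exists_one_le_mul_rpow_of_nonneg hs
    exact ⟨0, C, hC, fun z => by simpa using h z⟩
  · obtain ⟨j, C, hC, h⟩ := hΛ.exists_rpow_le_mul_pow_of_nonneg (neg_nonneg.2 hs)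
    refine ⟨j, C, hC, fun z => ?_⟩
    calc 1 = Λ z ^ (-s) * Λ z ^ s := by
          rw [← Real.rpow_add (hΛ.pos z), neg_add_cancel, Real.rpow_zero]
      _ ≤ _ := mul_le_mul_of_nonneg_right (h z) (Real.rpow_nonneg (hΛ.pos z).le s)

end HasPolynomialBounds

variable {n : ℕ}

theorem one_add_norm_le_two_mul_euclBracket (z : Rn n × Rn n) : 1 + ‖z‖ ≤ 2 * euclBracket z := by
  rw [euclBracket, euclNorm, Real.sq_sqrt (by positivity)]
  have hone : 1 ≤ √(1 + (‖z.1‖ ^ 2 + ‖z.2‖ ^ 2)) :=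
    Real.one_le_sqrt.2 (le_add_of_nonneg_right (by positivity))
  have hnorm : ‖z‖ ≤ √(1 + (‖z.1‖ ^ 2 + ‖z.2‖ ^ 2)) := by
    refine max_le ?_ ?_ <;> refine Real.le_sqrt_of_sq_le ?_ <;>
      linarith [sq_nonneg ‖z.1‖, sq_nonneg ‖z.2‖]
  linarith

theorem euclBracket_le_two_mul_one_add_norm (z : Rn n × Rn n) :
    euclBracket z ≤ 2 * (1 + ‖z‖) := by
  rw [euclBracket, euclNorm, Real.sq_sqrt (by positivity)]
  refine Real.sqrt_le_iff.2 ⟨by positivity, ?_⟩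
  have hfst : ‖z.1‖ ^ 2 ≤ ‖z‖ ^ 2 := by gcongr; exact norm_fst_le z
  have hsnd : ‖z.2‖ ^ 2 ≤ ‖z‖ ^ 2 := by gcongr; exact norm_snd_le z
  nlinarith [norm_nonneg z]

theorem IsWeight.hasPolynomialBounds {Λ : Rn n × Rn n → ℝ} (hΛ : IsWeight Λ) :
    HasPolynomialBounds Λ := by
  obtain ⟨-, ⟨μ, hμ, ⟨c, hc, hlower⟩, ⟨d, hd, hupper⟩, -⟩, -⟩ := hΛ
  refine ⟨μ, 1, 2 ^ μ * c, d * 2, hμ, by positivity, by positivity, fun z => ⟨?_, ?_⟩⟩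
  · calc (1 + ‖z‖) ^ μ ≤ (2 * euclBracket z) ^ μ :=
          Real.rpow_le_rpow (by positivity) (one_add_norm_le_two_mul_euclBracket z) hμ.le
      _ = 2 ^ μ * euclBracket z ^ μ := Real.mul_rpow zero_le_two (Real.sqrt_nonneg _)
      _ ≤ 2 ^ μ * (c * Λ z) := by gcongr; exact hlower z
      _ = 2 ^ μ * c * Λ z := (mul_assoc _ _ _).symm
  · calc Λ z ≤ d * euclBracket z := hupper z
      _ ≤ d * (2 * (1 + ‖z‖)) := by gcongr; exact euclBracket_le_two_mul_one_add_norm z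
      _ = d * 2 * (1 + ‖z‖) ^ (1 : ℝ) := by rw [Real.rpow_one, mul_assoc]

variable {Λ : Rn n × Rn n → ℝ} {a : Eps → Rn n × Rn n → ℂ}

theorem isSRegularNet_of_mem_smoothingSymbols (hΛ : HasPolynomialBounds Λ) {ρ : ℝ}
    (ha : a ∈ SmoothingSymbols Λ ρ) : IsSRegularNet a := by
  obtain ⟨N, h⟩ := Set.mem_iUnion.1 ha
  rw [Set.mem_iInter] at h
  refine ⟨(h 0).1, N, fun j k => ?_⟩
  obtain ⟨m, C, hm⟩ := hΛ.exists_pow_mul_rpow_le j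
  obtain ⟨c, hc, hsymb⟩ := (h (m + ρ * k)).2 k
  simp only [add_sub_cancel_right, ← div_eq_mul_inv] at hsymb
  refine ⟨c * C, fun ε z => ?_⟩
  have hbound : (ε : ℝ) ^ N * ‖iteratedFDeriv ℝ k (a ε) z‖ ≤ c * Λ z ^ m :=
    (le_div_iff₀' (pow_pos ε.2.1 N)).1 (hsymb ε z)
  have hz : ‖z‖ ^ j ≤ (1 + ‖z‖) ^ j := by gcongr; linarith
  calc (ε : ℝ) ^ N * (‖z‖ ^ j * ‖iteratedFDeriv ℝ k (a ε) z‖)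
      = ‖z‖ ^ j * ((ε : ℝ) ^ N * ‖iteratedFDeriv ℝ k (a ε) z‖) := by ring
    _ ≤ (1 + ‖z‖) ^ j * (c * Λ z ^ m) :=
        mul_le_mul hz hbound (mul_nonneg (pow_nonneg ε.2.1.le N) (norm_nonneg _)) (by positivity)
    _ = c * ((1 + ‖z‖) ^ j * Λ z ^ m) := by ring
    _ ≤ c * C := mul_le_mul_of_nonneg_left (hm z) hc.le

theorem IsSRegularNet.mem_smoothingSymbols (hΛ : HasPolynomialBounds Λ) (ρ : ℝ)
    (ha : IsSRegularNet a) : a ∈ SmoothingSymbols Λ ρ := by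
  obtain ⟨U, rfl⟩ := ha.exists_eq_coe
  obtain ⟨N, hN⟩ := isSRegularNet_coe_iff.1 ha
  refine Set.mem_iUnion.2 ⟨N, Set.mem_iInter.2 fun m => ⟨ha.1, fun k => ?_⟩⟩
  obtain ⟨j, C, hC, hΛs⟩ := hΛ.exists_one_le_mul_rpow (m - ρ * k)
  let p := (Finset.Iic (j, k)).sup (schwartzSeminormFamily ℝ (Rn n × Rn n) ℂ)
  have hp : Continuous p := Seminorm.continuous_finsetSup fun i _ =>
    (schwartz_withSeminorms ℝ _ ℂ).continuous_seminorm i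
  obtain ⟨D, hD⟩ := hN p hp
  refine ⟨2 ^ j * (|D| + 1) * C, by positivity, fun ε z => ?_⟩
  have hs := Real.rpow_nonneg (hΛ.pos z).le (m - ρ * k)
  have hDε : p (U ε) ≤ (|D| + 1) * ((ε : ℝ) ^ N)⁻¹ :=
    (hD ε).trans (mul_le_mul_of_nonneg_right (by linarith [le_abs_self D])
      (inv_nonneg.2 (pow_nonneg ε.2.1.le N)))
  have hU : (1 + ‖z‖) ^ j * ‖iteratedFDeriv ℝ k (U ε) z‖ ≤ 2 ^ j * p (U ε) :=
    SchwartzMap.one_add_le_sup_seminorm_apply (𝕜 := ℝ) (m := (j, k)) le_rfl le_rfl (U ε) z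
  calc ‖iteratedFDeriv ℝ k (U ε) z‖
      ≤ ‖iteratedFDeriv ℝ k (U ε) z‖ * (C * (1 + ‖z‖) ^ j * Λ z ^ (m - ρ * k)) :=
        le_mul_of_one_le_right (norm_nonneg _) (hΛs z)
    _ = (1 + ‖z‖) ^ j * ‖iteratedFDeriv ℝ k (U ε) z‖ * (C * Λ z ^ (m - ρ * k)) := by ring
    _ ≤ 2 ^ j * ((|D| + 1) * ((ε : ℝ) ^ N)⁻¹) * (C * Λ z ^ (m - ρ * k)) :=
        mul_le_mul_of_nonneg_right (hU.trans (mul_le_mul_of_nonneg_left hDε (by positivity)))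
          (mul_nonneg hC.le hs)
    _ = 2 ^ j * (|D| + 1) * C * Λ z ^ (m - ρ * k) * ((ε : ℝ) ^ N)⁻¹ := by ring

theorem mem_smoothingSymbols_iff (hΛ : HasPolynomialBounds Λ) (ρ : ℝ) :
    a ∈ SmoothingSymbols Λ ρ ↔ IsSRegularNet a :=
  ⟨isSRegularNet_of_mem_smoothingSymbols hΛ, fun ha => ha.mem_smoothingSymbols hΛ ρ⟩

end Weights

section OscillatoryIntegrals

variable {n : ℕ} {θ : Rn n × Rn n → ℝ} {b : Rn n × Rn n → ℂ}

theorem exists_schwartz_apply_zero_eq_one (V : Type*) [NormedAddCommGroup V] [NormedSpace ℝ V]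
    [FiniteDimensional ℝ V] : ∃ ψ : 𝓢(V, ℂ), ψ 0 = 1 := by
  let b : ContDiffBump (0 : V) := ⟨1, 2, one_pos, one_lt_two⟩
  have hsupp : HasCompactSupport fun x => (b x : ℂ) :=
    b.hasCompactSupport.comp_left Complex.ofReal_zero
  refine ⟨hsupp.toSchwartzMap (Complex.ofRealCLM.contDiff.comp b.contDiff), ?_⟩
  change (b 0 : ℂ) = 1
  rw [b.one_of_mem_closedBall (Metric.mem_closedBall_self zero_le_one), Complex.ofReal_one]

theorem IsOscIntegral.unique {I J : ℂ} (hI : IsOscIntegral θ b I) (hJ : IsOscIntegral θ b J) :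
    I = J := by
  obtain ⟨ψ, hψ⟩ := exists_schwartz_apply_zero_eq_one (Rn n × Rn n)
  exact tendsto_nhds_unique (hI ψ hψ).2 (hJ ψ hψ).2

theorem isOscIntegral_of_integrable (hb : Integrable fun z => Complex.exp (Complex.I * θ z) * b z) :
    IsOscIntegral θ b (∫ z, Complex.exp (Complex.I * θ z) * b z) := by
  intro ψ hψ
  have hbound (h : ℝ) (z : Rn n × Rn n) : ‖ψ (h • z)‖ ≤ SchwartzMap.seminorm ℝ 0 0 ψ :=
    ψ.norm_le_seminorm ℝ _
  have hint (h : ℝ) : Integrable fun z => Complex.exp (Complex.I * θ z) * b z * ψ (h • z) :=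
    hb.mul_bdd (ψ.continuous.comp (continuous_const_smul h)).aestronglyMeasurable
      (.of_forall (hbound h))
  refine ⟨fun h _ => hint h, tendsto_integral_filter_of_dominated_convergence
    (fun z => ‖Complex.exp (Complex.I * θ z) * b z‖ * SchwartzMap.seminorm ℝ 0 0 ψ)
    (.of_forall fun h => (hint h).aestronglyMeasurable)
    (.of_forall fun h => .of_forall fun z => ?_) (hb.norm.mul_const _)
    (.of_forall fun z => ?_)⟩
  · exact (norm_mul_le _ _).trans (mul_le_mul_of_nonneg_left (hbound h z) (norm_nonneg _))
  · have hlim : Tendsto (fun h : ℝ => ψ (h • z)) (𝓝[>] 0) (𝓝 (ψ ((0 : ℝ) • z))) :=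
      ((ψ.continuous.comp (by fun_prop : Continuous fun h : ℝ => h • z)).tendsto 0).mono_left
        nhdsWithin_le_nhds
    rw [zero_smul, hψ] at hlim
    simpa using hlim.const_mul (Complex.exp (Complex.I * θ z) * b z)

theorem isOscIntegral_iff_of_integrable
    (hb : Integrable fun z => Complex.exp (Complex.I * θ z) * b z) {I : ℂ} :
    IsOscIntegral θ b I ↔ I = ∫ z, Complex.exp (Complex.I * θ z) * b z :=
  ⟨fun hI => hI.unique (isOscIntegral_of_integrable hb),
    fun hI => hI ▸ isOscIntegral_of_integrable hb⟩

theorem integrable_cexp_mul_schwartz (a : 𝓢(Rn n × Rn n, ℂ)) {w : Rn n → ℂ} (hw : Integrable w)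
    (x : Rn n) : Integrable fun z : Rn n × Rn n =>
      Complex.exp (Complex.I * (inner ℝ (x - z.1) z.2 : ℝ)) * (w z.1 * a (x, z.2)) := by
  refine (hw.mul_prod (slice x a).integrable).bdd_mul (c := 1) ?_ (.of_forall fun z => ?_)
  · exact (by fun_prop : Continuous fun z : Rn n × Rn n =>
      Complex.exp (Complex.I * (inner ℝ (x - z.1) z.2 : ℝ))).aestronglyMeasurable
  · rw [mul_comm Complex.I, Complex.norm_exp_ofReal_mul_I]

theorem integral_cexp_mul_schwartz (a : 𝓢(Rn n × Rn n, ℂ)) {w : Rn n → ℂ} (hw : Integrable w)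
    (x : Rn n) :
    (((2 * Real.pi) ^ n)⁻¹ : ℝ) * ∫ z : Rn n × Rn n,
      Complex.exp (Complex.I * (inner ℝ (x - z.1) z.2 : ℝ)) * (w z.1 * a (x, z.2)) =
    ∫ y, kernelOfSymbol a (x, y) * w y := by
  rw [Measure.volume_eq_prod, integral_prod _ (integrable_cexp_mul_schwartz a hw x),
    ← integral_const_mul]
  refine integral_congr_ae (.of_forall fun y => ?_)
  beta_reduce
  rw [kernelOfSymbol_apply, finrank_euclideanSpace, Fintype.card_fin, mul_assoc,
    ← integral_mul_const]
  congr 2 with ξ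
  ring

theorem isOscIntegral_iff_eq_integral_kernelOfSymbol (a : 𝓢(Rn n × Rn n, ℂ)) {u g : Rn n → ℂ}
    (hug : Integrable fun y => u y * g y) (x : Rn n) {I : ℂ} :
    IsOscIntegral (fun z => -inner ℝ z.1 z.2)
      (fun z => (((2 * Real.pi) ^ n)⁻¹ : ℝ) * (Complex.exp (Complex.I * (inner ℝ x z.2 : ℝ)) *
        a (x, z.2) * u z.1 * g z.1)) I ↔
    I = ∫ y, kernelOfSymbol a (x, y) * u y * g y := by
  have hphase (z : Rn n × Rn n) : Complex.exp (Complex.I * ((-inner ℝ z.1 z.2 : ℝ) : ℂ)) *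
      ((((2 * Real.pi) ^ n)⁻¹ : ℝ) * (Complex.exp (Complex.I * (inner ℝ x z.2 : ℝ)) *
        a (x, z.2) * u z.1 * g z.1)) =
      (((2 * Real.pi) ^ n)⁻¹ : ℝ) * (Complex.exp (Complex.I * (inner ℝ (x - z.1) z.2 : ℝ)) *
        (u z.1 * g z.1 * a (x, z.2))) := by
    rw [sub_eq_neg_add, inner_add_left, inner_neg_left, Complex.ofReal_add, mul_add,
      Complex.exp_add]
    ring
  have hint := (integrable_cexp_mul_schwartz a hug x).const_mul
    ((((2 * Real.pi) ^ n)⁻¹ : ℝ) : ℂ)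
  rw [isOscIntegral_iff_of_integrable (by simpa only [hphase] using hint)]
  simp only [hphase, integral_const_mul, integral_cexp_mul_schwartz a hug x]
  simp only [mul_assoc]

end OscillatoryIntegrals

section Operators

variable {n : ℕ} {φ : 𝓢(Rn n, ℂ)} {A : GtauS (Rn n) →ₗ[ℂ] GtauS (Rn n)}

/-- The net `(k_ε)_ε` is a kernel of `A`: the image of the class of `(u_ε)_ε` is the class of the
net `∫ k_ε(x,y) u_ε(y) (φ_ε)^(y) dy`. -/
def IsKernelNet (φ : 𝓢(Rn n, ℂ)) (k : Eps → Rn n × Rn n → ℂ)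
    (A : GtauS (Rn n) →ₗ[ℂ] GtauS (Rn n)) : Prop :=
  ∀ u : Tempered (Rn n), ∃ v : Tempered (Rn n),
    (∀ ε x, v.1 ε x = ∫ y, k ε (x, y) * u.1 ε y * scaledHat φ ε y) ∧
    A (GtauS.mk u) = GtauS.mk v

theorem IsKernelNet.of_sub_mem_negligible {k l : Eps → Rn n × Rn n → ℂ} (hA : IsKernelNet φ l A)
    (hl : IsSRegularNet l) (hkl : k - l ∈ Negligible (Rn n × Rn n)) : IsKernelNet φ k A := by
  intro u
  obtain ⟨v, hv, hAv⟩ := hA u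
  have hw := integral_mem_negligible φ hkl u.2
  refine ⟨v + ⟨_, negligible_le_tempered _ hw⟩, fun ε x => ?_, ?_⟩
  · obtain ⟨L, rfl⟩ := hl.exists_eq_coe
    obtain ⟨M, hM⟩ := exists_eq_coe_of_mem_negligible hkl
    have hint (f : 𝓢(Rn n × Rn n, ℂ)) :
        Integrable fun y => f (x, y) * u.1 ε y * scaledHat φ ε y :=
      integrable_schwartz_mul_mul_scaledHat φ u.2 ε (slice x f)
    change v.1 ε x + ∫ y, (k - fun ε => ⇑(L ε)) ε (x, y) * u.1 ε y * scaledHat φ ε y = _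
    rw [hv, hM, ← integral_add (hint (L ε)) (hint (M ε))]
    refine integral_congr_ae (.of_forall fun y => ?_)
    have hk : k ε (x, y) = L ε (x, y) + M ε (x, y) :=
      eq_add_of_sub_eq' (congrFun (congrFun hM ε) (x, y))
    simp only [hk, add_mul]
  · rw [hAv]
    refine (Submodule.Quotient.eq _).2 ?_
    rw [sub_add_cancel_left]
    exact neg_mem hw

theorem hasSRegularKernel_iff_exists_isKernelNet :
    HasSRegularKernel φ A ↔ ∃ k, IsSRegularNet k ∧ IsKernelNet φ k A := by
  constructor
  · rintro ⟨_, ⟨k, rfl, hk⟩, hA⟩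
    exact ⟨k.1, hk, hA k rfl⟩
  · rintro ⟨l, hl, hA⟩
    refine ⟨GtauS.mk ⟨l, hl.mem_tempered⟩, ⟨_, rfl, hl⟩, fun k hk => ?_⟩
    exact hA.of_sub_mem_negligible hl
      ((Submodule.Quotient.eq ((Negligible _).submoduleOf (Tempered _))).1 hk)

theorem isPseudoDiffOp_coe_iff_isKernelNet {a : Eps → 𝓢(Rn n × Rn n, ℂ)} :
    IsPseudoDiffOp φ (fun ε x _ ξ => a ε (x, ξ)) A ↔
      IsKernelNet φ (fun ε => ⇑(kernelOfSymbol (a ε))) A := by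
  simp only [IsPseudoDiffOp, IsKernelNet, isOscIntegral_iff_eq_integral_kernelOfSymbol,
    integrable_mul_scaledHat, Subtype.prop]

end Operators

end Colombeau

end

open Colombeau in
theorem proposition5p5_general (n : ℕ) (φ : 𝓢(Rn n, ℂ)) (Λ : Rn n × Rn n → ℝ)
    (hΛ : HasPolynomialBounds Λ) (ρ : ℝ) (A : GtauS (Rn n) →ₗ[ℂ] GtauS (Rn n)) :
    HasSRegularKernel φ A ↔
      ∃ a ∈ SmoothingSymbols Λ ρ, IsPseudoDiffOp φ (fun ε x _ ξ => a ε (x, ξ)) A := by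
  simp only [hasSRegularKernel_iff_exists_isKernelNet, mem_smoothingSymbols_iff hΛ]
  constructor
  · rintro ⟨k, hk, hA⟩
    obtain ⟨K, rfl⟩ := hk.exists_eq_coe
    refine ⟨fun ε => kernelOfSymbol.symm (K ε), hk.map kernelOfSymbol.symm.toContinuousLinearMap,
      isPseudoDiffOp_coe_iff_isKernelNet.2 ?_⟩
    simpa only [ContinuousLinearEquiv.apply_symm_apply] using hA
  · rintro ⟨a, ha, hA⟩
    obtain ⟨U, rfl⟩ := ha.exists_eq_coe
    exact ⟨fun ε => kernelOfSymbol (U ε), ha.map kernelOfSymbol.toContinuousLinearMap,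
      isPseudoDiffOp_coe_iff_isKernelNet.1 hA⟩

theorem proposition5p5 (n : ℕ) (φ : 𝓢(Colombeau.Rn n, ℂ)) (hφ : Colombeau.IsMollifier φ)
    (Λ : Colombeau.Rn n × Colombeau.Rn n → ℝ) (hΛ : Colombeau.IsWeight Λ)
    (ρ : ℝ) (hρ0 : 0 < ρ) (hρ1 : ρ ≤ 1)
    (A : Colombeau.GtauS (Colombeau.Rn n) →ₗ[ℂ] Colombeau.GtauS (Colombeau.Rn n)) :
    Colombeau.HasSRegularKernel φ A ↔
      ∃ a ∈ Colombeau.SmoothingSymbols Λ ρ,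
        Colombeau.IsPseudoDiffOp φ (fun ε x _ ξ => a ε (x, ξ)) A :=
  proposition5p5_general n φ Λ hΛ.hasPolynomialBounds ρ A
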